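/- Let $k\ge 3$ and let $f_0$ be a normal form of a Whitney umbrella, $$f_0(u,v)=\Bigl(u,\;uv+\sum_{i=3}^k\frac{b_i}{i!}v^i+R_1(u,v),\;\sum_{j=2}^k\sum_{p+q=j}\frac{a_{pq}}{p!\,q!}u^pv^q+R_2(u,v)\Bigr),\qquad a_{02}>0,$$ with real coefficients, where $R_1,R_2$ are real functions that are $C^\infty$ near the origin and whose derivatives of order $\le k$ all vanish at the origin. For $r>0$ put $\hat\gamma(\theta)=f_0(r\cos\theta,r\sin\theta)$, and let $\tilde{\mathbf n}(r,\theta)$ be the unit normal $(f_0)_u\times(f_0)_v/|(f_0)_u\times(f_0)_v|$ at $(r\cos\theta,r\sin\theta)$. A frame of the type considered consists of $\mathbf e,\mathbf b,\mathbf n$ along $\hat\gamma$, differentiable in $\theta$, with $\hat\gamma_\theta=l\,\mathbf e$ for a function $l$, $|\mathbf e|=|\mathbf n|=1$, $\mathbf n=-\mathbf e\times\tilde{\mathbf n}$ (so $\mathbf e\cdot\mathbf n=0$) and $\mathbf b=-\mathbf e\times\mathbf n$; the functions $\kappa_1,\kappa_2,\kappa_3$ of $(r,\theta)$ are given by $$\mathbf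 e'=\kappa_1\mathbf b+\kappa_2\mathbf n,\qquad \mathbf b'=-\kappa_1\mathbf e+\kappa_3\mathbf n,\qquad \mathbf n'=-\kappa_2\mathbf e-\kappa_3\mathbf b\qquad({}'=d/d\theta).$$ A function $x_f(\theta)$ is called a first term of a function $x(r,\theta)$ on a set $S$ of angles if $x_f$ is not identically zero on $S$ and there are an integer $i\ge0$ and a function $x_0$ without zeros on $S$ such that, for each $\theta\in S$, $x(r,\theta)=x_f(\theta)x_0(\theta)r^i+O(r^{i+1})$ as $r\to+0$. Let $$g(s)=(a_{11}^2+1)s^4+a_{11}a_{02}s^3+3(a_{11}^2+1)s^2+a_{11}(4a_{02}-a_{20})s+a_{02}(a_{02}-a_{20}).$$ Theorem. For all sufficiently small $r>0$ such a frame exists. For every choice of such frames for all small $r>0$, the function $\kappa_2(r,\theta)$ has a first term on $S=\{\theta\in\mathbb R:\sin\theta\ne0\}$, and every first term $c$ of $\kappa_2$ on $S$ satisfies, for each $\theta\in S$, $$c(\theta)=0\iff g\Bigl(\frac{\cos\theta}{\sin\theta}\Bigr)=0 .$$ -/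

import Mathlib

open scoped Topology ContDiff Matrix

/-- `R` is a smooth function germ at the origin of the plane of order at least `m`: it is
`C^∞` near `0` and all its derivatives of order less than `m` vanish at `0`. -/
def IsGermOfOrder (m : ℕ) (R : ℝ × ℝ → ℝ) : Prop :=
  (∀ᶠ p in 𝓝 (0 : ℝ × ℝ), ContDiffAt ℝ ∞ R p) ∧
    ∀ j : ℕ, j < m → iteratedFDeriv ℝ j R 0 = 0

/-- The normal form of a Whitney umbrella
`(u, u v + ∑_{i=3}^k b_i v^i / i! + R₁, ∑_{j=2}^k ∑_{p+q=j} a_{pq} u^p v^q / (p! q!) + R₂)`. -/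
noncomputable def whitneyNormalForm (k : ℕ) (a : ℕ → ℕ → ℝ) (b : ℕ → ℝ) (R₁ R₂ : ℝ × ℝ → ℝ)
    (p : ℝ × ℝ) : Fin 3 → ℝ :=
  ![p.1,
    p.1 * p.2 + ∑ i ∈ Finset.Icc 3 k, b i / (i.factorial : ℝ) * p.2 ^ i + R₁ p,
    ∑ j ∈ Finset.Icc 2 k, ∑ q ∈ Finset.HasAntidiagonal.antidiagonal j,
      a q.1 q.2 / ((q.1.factorial : ℝ) * (q.2.factorial : ℝ)) * p.1 ^ q.1 * p.2 ^ q.2 + R₂ p]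

/-- The normal vector `f_u × f_v`. -/
noncomputable def normalVec (f : ℝ × ℝ → Fin 3 → ℝ) (p : ℝ × ℝ) : Fin 3 → ℝ :=
  (fderiv ℝ f p (1, 0)) ⨯₃ (fderiv ℝ f p (0, 1))

/-- The unit normal vector `f_u × f_v / |f_u × f_v|` (Euclidean length). -/
noncomputable def unitNormal (f : ℝ × ℝ → Fin 3 → ℝ) (p : ℝ × ℝ) : Fin 3 → ℝ :=
  (Real.sqrt (normalVec f p ⬝ᵥ normalVec f p))⁻¹ • normalVec f p

/-- The point `(r cos θ, r sin θ)`. -/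
noncomputable def polarPt (r θ : ℝ) : ℝ × ℝ := (r * Real.cos θ, r * Real.sin θ)

/-- `e, b, n` is an orthonormal frame along the space curve `γ` with `γ' = l e`, `b = -e × n`,
and `κ₁, κ₂, κ₃` are the functions in its Frenet-Serre type formula. -/
structure IsFrenetFrame (γ : ℝ → Fin 3 → ℝ) (l : ℝ → ℝ) (e b n : ℝ → Fin 3 → ℝ)
    (κ₁ κ₂ κ₃ : ℝ → ℝ) : Prop where
  tangent : ∀ t, HasDerivAt γ (l t • e t) t
  unit_e : ∀ t, e t ⬝ᵥ e t = 1
  unit_n : ∀ t, n t ⬝ᵥ n t = 1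
  orth : ∀ t, e t ⬝ᵥ n t = 0
  b_eq : ∀ t, b t = -(e t ⨯₃ n t)
  deriv_e : ∀ t, HasDerivAt e (κ₁ t • b t + κ₂ t • n t) t
  deriv_b : ∀ t, HasDerivAt b (-(κ₁ t) • e t + κ₃ t • n t) t
  deriv_n : ∀ t, HasDerivAt n (-(κ₂ t) • e t - κ₃ t • b t) t

/-- The frame along the image under `f` of the circle of radius `r`, parametrized by the angle,
whose third vector is `n = -e × ñ`, with `ñ` the unit normal of `f` along that curve. -/
def IsConormalFrame (f : ℝ × ℝ → Fin 3 → ℝ) (r : ℝ) (l : ℝ → ℝ) (e b n : ℝ → Fin 3 → ℝ)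
    (κ₁ κ₂ κ₃ : ℝ → ℝ) : Prop :=
  IsFrenetFrame (fun θ => f (polarPt r θ)) l e b n κ₁ κ₂ κ₃ ∧
    ∀ θ, n θ = -(e θ ⨯₃ unitNormal f (polarPt r θ))

/-- `xf` is a first term of the function `x (r, θ)` for `θ ∈ S`, as `r → +0`:
`x (r, θ) = xf (θ) x₀ (θ) r ^ i + O (r ^ (i + 1))` for some `i` and some `x₀` without zeros on `S`.
The order `i` is the one at which `x` starts: `xf` is not identically zero on `S`
(it may vanish at some `θ`). -/
def IsFirstTerm (x : ℝ → ℝ → ℝ) (S : Set ℝ) (xf : ℝ → ℝ) : Prop :=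
  (∃ θ ∈ S, xf θ ≠ 0) ∧
    ∃ (i : ℕ) (x₀ : ℝ → ℝ), (∀ θ ∈ S, x₀ θ ≠ 0) ∧
      ∀ θ ∈ S, (fun r : ℝ => x r θ - xf θ * x₀ θ * r ^ i) =O[𝓝[>] 0] fun r : ℝ => r ^ (i + 1)

/-- The quartic polynomial that governs the geodesic curvature. -/
def quarticG (a20 a11 a02 s : ℝ) : ℝ :=
  (a11 ^ 2 + 1) * s ^ 4 + a11 * a02 * s ^ 3 + 3 * (a11 ^ 2 + 1) * s ^ 2
    + a11 * (4 * a02 - a20) * s + a02 * (a02 - a20)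

/-!
Write `T = f_θ`, `X = f_θθ` along the circle of radius `r`, and `N = f_u × f_v`. Differentiating
`T ⬝ n = 0` gives `l κ₂ = X ⬝ n`, and as `e` and `n` are determined by `T` and `N` this becomes
`κ₂ = -X ⬝ (T × N) / (|T|² |N|)`. The numerator, `|T|²` and `|N|²` are smooth germs at the origin,
and the 2-jet of the umbrella already determines their leading forms, of degrees 4, 2 and 2. The
leading form of `|N|²` is positive definite, that of `|T|²` is `v²`, and that of the numerator is
the homogenization of `g`. Hence `κ₂ = g(cot θ) x₀(θ) r + O(r²)` with `x₀` without zeros where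
`sin θ ≠ 0`. The order `i` of a first term is forced, being the exact order of `x(r, θ)` at any
angle where the first term does not vanish, so two first terms differ by a factor without zeros.
-/

open Filter Asymptotics

section TaylorEstimate

theorem isBigO_norm_pow_succ_of_fderiv {E F : Type*} [NormedAddCommGroup E] [NormedSpace ℝ E]
    [NormedAddCommGroup F] [NormedSpace ℝ F] {f : E → F} {a : E} {m : ℕ}
    (hf : ∀ᶠ x in 𝓝 a, DifferentiableAt ℝ f x) (ha : f a = 0)
    (h : fderiv ℝ f =O[𝓝 a] fun x => ‖x - a‖ ^ m) : f =O[𝓝 a] fun x => ‖x - a‖ ^ (m + 1) := by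
  obtain ⟨C, hC, hb⟩ := h.exists_pos
  obtain ⟨ε, hε, hball⟩ := Metric.eventually_nhds_iff_ball.1 (hf.and hb.bound)
  refine .of_bound C (Metric.eventually_nhds_iff_ball.2 ⟨ε, hε, fun x hx => ?_⟩)
  have hsub : Metric.closedBall a ‖x - a‖ ⊆ Metric.ball a ε :=
    Metric.closedBall_subset_ball (by rwa [← dist_eq_norm])
  have hmean := (convex_closedBall a ‖x - a‖).norm_image_sub_le_of_norm_fderiv_le (𝕜 := ℝ)
    (C := C * ‖x - a‖ ^ m) (fun y hy => (hball y (hsub hy)).1) (fun y hy => ?_)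
    (Metric.mem_closedBall_self (norm_nonneg _))
    (show x ∈ Metric.closedBall a ‖x - a‖ by simp [dist_eq_norm])
  · simpa [ha, pow_succ, mul_assoc] using hmean
  · refine (hball y (hsub hy)).2.trans ?_
    rw [norm_pow, norm_norm, ← dist_eq_norm y]
    gcongr
    exact hy

universe u

theorem isBigO_norm_pow_of_iteratedFDeriv_eq_zero {E F : Type u} [NormedAddCommGroup E]
    [NormedSpace ℝ E] [NormedAddCommGroup F] [NormedSpace ℝ F] {f : E → F} {a : E} {m : ℕ}
    (hf : ContDiffAt ℝ m f a) (h : ∀ j < m, iteratedFDeriv ℝ j f a = 0) :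
    f =O[𝓝 a] fun x => ‖x - a‖ ^ m := by
  induction m generalizing F f with
  | zero => simpa using hf.continuousAt.isBigO_one ℝ
  | succ m ih =>
    have hdiff : ∀ᶠ x in 𝓝 a, DifferentiableAt ℝ f x :=
      (hf.eventually (by simp)).mono fun x hx => hx.differentiableAt (by simp)
    have hfderiv := ih (hf.fderiv_right (m := m) (by simp)) fun j hj => by
      rw [← norm_eq_zero, norm_iteratedFDeriv_fderiv, h (j + 1) (by omega), norm_zero]
    have hfa : f a = 0 := by simpa using congrArg (fun L => L ![]) (h 0 m.succ_pos)
    exact isBigO_norm_pow_succ_of_fderiv hdiff hfa hfderiv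

end TaylorEstimate

namespace IsGermOfOrder

variable {m n : ℕ} {F G : ℝ × ℝ → ℝ}

theorem mono (h : IsGermOfOrder n F) (hmn : m ≤ n) : IsGermOfOrder m F :=
  ⟨h.1, fun j hj => h.2 j (hj.trans_le hmn)⟩

theorem contDiffAt (h : IsGermOfOrder m F) : ContDiffAt ℝ ∞ F 0 := h.1.self_of_nhds

theorem isBigO (hF : IsGermOfOrder m F) : F =O[𝓝 0] fun p => ‖p‖ ^ m := by
  simpa using isBigO_norm_pow_of_iteratedFDeriv_eq_zero
    (hF.contDiffAt.of_le (mod_cast le_top)) hF.2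

theorem congr (hF : IsGermOfOrder m F) (h : F =ᶠ[𝓝 0] G) : IsGermOfOrder m G := by
  refine ⟨?_, fun j hj => ?_⟩
  · filter_upwards [hF.1, h.eventuallyEq_nhds] with p hp hpG using hp.congr_of_eventuallyEq hpG.symm
  · rw [← (h.iteratedFDeriv ℝ j).self_of_nhds, hF.2 j hj]

theorem of_contDiff (hF : ContDiff ℝ ∞ F) : IsGermOfOrder 0 F :=
  ⟨.of_forall fun _ => hF.contDiffAt, fun _ hj => absurd hj (Nat.not_lt_zero _)⟩

theorem one_of_contDiff (hF : ContDiff ℝ ∞ F) (h0 : F 0 = 0) : IsGermOfOrder 1 F := by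
  refine ⟨.of_forall fun _ => hF.contDiffAt, fun j hj => ?_⟩
  obtain rfl : j = 0 := by omega
  ext v
  simp [h0]

theorem fst : IsGermOfOrder 1 (fun p => p.1) := one_of_contDiff contDiff_fst rfl

theorem snd : IsGermOfOrder 1 (fun p => p.2) := one_of_contDiff contDiff_snd rfl

theorem zero : IsGermOfOrder m (fun _ => 0) :=
  ⟨.of_forall fun _ => contDiffAt_const, fun j _ => by rw [iteratedFDeriv_fun_zero]; rfl⟩

theorem add (hF : IsGermOfOrder m F) (hG : IsGermOfOrder m G) :
    IsGermOfOrder m (fun p => F p + G p) := by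
  refine ⟨?_, fun j hj => ?_⟩
  · filter_upwards [hF.1, hG.1] with p h₁ h₂ using h₁.add h₂
  · have := iteratedFDeriv_add_apply (i := j) (hF.contDiffAt.of_le (mod_cast le_top))
      (hG.contDiffAt.of_le (mod_cast le_top))
    rw [hF.2 j hj, hG.2 j hj, add_zero] at this
    exact this

theorem mul (hF : IsGermOfOrder m F) (hG : IsGermOfOrder n G) :
    IsGermOfOrder (m + n) (fun p => F p * G p) := by
  refine ⟨?_, fun j hj => ?_⟩
  · filter_upwards [hF.1, hG.1] with p h₁ h₂ using h₁.mul h₂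
  obtain ⟨s, hs, hso, h0⟩ := eventually_nhds_iff.1 (hF.1.and hG.1)
  have leibniz := norm_iteratedFDerivWithin_mul_le (𝕜 := ℝ) (N := ∞) (n := j)
    (fun p hp => (hs p hp).1.contDiffWithinAt) (fun p hp => (hs p hp).2.contDiffWithinAt)
    hso.uniqueDiffOn h0 (mod_cast le_top)
  simp only [iteratedFDerivWithin_of_isOpen _ hso h0] at leibniz
  rw [Finset.sum_eq_zero] at leibniz
  · exact norm_le_zero_iff.1 leibniz
  · intro i hi
    obtain him | him : i < m ∨ j - i < n := by
      rw [Finset.mem_range] at hi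
      omega
    · simp [hF.2 i him]
    · simp [hG.2 (j - i) him]

theorem const_mul (c : ℝ) (hF : IsGermOfOrder m F) : IsGermOfOrder m (fun p => c * F p) := by
  simpa using (of_contDiff (contDiff_const (c := c))).mul hF

theorem neg (hF : IsGermOfOrder m F) : IsGermOfOrder m (fun p => -F p) := by
  simpa using hF.const_mul (-1)

theorem pow (hF : IsGermOfOrder m F) (n : ℕ) : IsGermOfOrder (n * m) (fun p => F p ^ n) := by
  induction n with
  | zero => simpa using of_contDiff (contDiff_const (c := (1 : ℝ)))
  | succ n ih => simpa [pow_succ, add_mul] using ih.mul hF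

theorem sum {ι : Type*} (s : Finset ι) {F : ι → ℝ × ℝ → ℝ}
    (h : ∀ i ∈ s, IsGermOfOrder m (F i)) : IsGermOfOrder m (fun p => ∑ i ∈ s, F i p) := by
  classical
  induction s using Finset.induction_on with
  | empty => simpa using zero
  | insert i s hi ih =>
    simp only [Finset.sum_insert hi]
    exact (h i (s.mem_insert_self i)).add (ih fun j hj => h j (Finset.mem_insert_of_mem hj))

theorem fderiv_apply (hF : IsGermOfOrder (m + 1) F) (w : ℝ × ℝ) :
    IsGermOfOrder m (fun p => fderiv ℝ F p w) := by
  have hsmooth : ∀ᶠ p in 𝓝 (0 : ℝ × ℝ), ContDiffAt ℝ ∞ (fderiv ℝ F) p := by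
    filter_upwards [hF.1] with p hp using hp.fderiv_right (by simp)
  refine ⟨?_, fun j hj => ?_⟩
  · filter_upwards [hsmooth] with p hp using hp.clm_apply contDiffAt_const
  · have hle := (ContinuousLinearMap.apply ℝ ℝ w).norm_iteratedFDeriv_comp_left (n := j)
      hsmooth.self_of_nhds (mod_cast le_top)
    rw [norm_iteratedFDeriv_fderiv, hF.2 (j + 1) (by omega)] at hle
    exact norm_le_zero_iff.1 (hle.trans (by simp))

end IsGermOfOrder

section PolarCoordinates

theorem polarPt_ne_zero {r : ℝ} (hr : r ≠ 0) (θ : ℝ) : polarPt r θ ≠ 0 := by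
  intro h
  have hcos : Real.cos θ = 0 := by simpa [polarPt, hr] using congrArg Prod.fst h
  have hsin : Real.sin θ = 0 := by simpa [polarPt, hr] using congrArg Prod.snd h
  simpa [hcos, hsin] using Real.sin_sq_add_cos_sq θ

theorem norm_polarPt_le (r θ : ℝ) : ‖polarPt r θ‖ ≤ |r| := by
  refine max_le ?_ ?_ <;> simp only [polarPt, Real.norm_eq_abs, abs_mul]
  · exact mul_le_of_le_one_right (abs_nonneg r) (Real.abs_cos_le_one θ)
  · exact mul_le_of_le_one_right (abs_nonneg r) (Real.abs_sin_le_one θ)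

theorem tendsto_polarPt (θ : ℝ) : Tendsto (fun r => polarPt r θ) (𝓝[>] 0) (𝓝 0) :=
  squeeze_zero_norm (norm_polarPt_le · θ)
    (by simpa using (continuous_abs.tendsto (0 : ℝ)).mono_left nhdsWithin_le_nhds)

theorem eventually_forall_polarPt {P : ℝ × ℝ → Prop} (h : ∀ᶠ p in 𝓝[≠] 0, P p) :
    ∀ᶠ r in 𝓝[>] 0, ∀ θ, P (polarPt r θ) := by
  obtain ⟨ε, hε, hP⟩ := Metric.eventually_nhds_iff_ball.1 (eventually_nhdsWithin_iff.1 h)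
  filter_upwards [Ioo_mem_nhdsGT hε] with r hr θ
  refine hP _ ?_ (polarPt_ne_zero hr.1.ne' θ)
  rw [mem_ball_zero_iff]
  exact (norm_polarPt_le r θ).trans_lt (by rw [abs_of_pos hr.1]; exact hr.2)

theorem hasDerivAt_polarPt (r θ : ℝ) :
    HasDerivAt (polarPt r) (-(polarPt r θ).2, (polarPt r θ).1) θ := by
  have h := ((Real.hasDerivAt_cos θ).const_mul r).prodMk ((Real.hasDerivAt_sin θ).const_mul r)
  convert h using 2 <;> simp [polarPt]

variable {E : Type*} [NormedAddCommGroup E] [NormedSpace ℝ E]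

/-- The derivative of `f` along the rotation field `(-v, u)`, that is, `∂f/∂θ` in polar coordinates
`(u, v) = (r cos θ, r sin θ)`. -/
noncomputable def angularDeriv (f : ℝ × ℝ → E) (p : ℝ × ℝ) : E := fderiv ℝ f p (-p.2, p.1)

theorem angularDeriv_eq (f : ℝ × ℝ → E) (p : ℝ × ℝ) :
    angularDeriv f p = -p.2 • fderiv ℝ f p (1, 0) + p.1 • fderiv ℝ f p (0, 1) := by
  rw [← map_smul, ← map_smul, ← map_add]
  simp [angularDeriv]

theorem hasDerivAt_comp_polarPt {f : ℝ × ℝ → E} {r θ : ℝ}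
    (hf : DifferentiableAt ℝ f (polarPt r θ)) :
    HasDerivAt (fun t => f (polarPt r t)) (angularDeriv f (polarPt r θ)) θ :=
  hf.hasFDerivAt.comp_hasDerivAt θ (hasDerivAt_polarPt r θ)

theorem differentiableAt_fderiv_apply {V : Type*} [NormedAddCommGroup V] [NormedSpace ℝ V]
    {f : V → E} {p : V} (hf : ContDiffAt ℝ 2 f p) (w : V) :
    DifferentiableAt ℝ (fun q => fderiv ℝ f q w) p :=
  ((hf.fderiv_right (m := 1) (by norm_num)).differentiableAt one_ne_zero).clm_apply
    (differentiableAt_const w)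

theorem differentiableAt_angularDeriv {f : ℝ × ℝ → E} {p : ℝ × ℝ} (hf : ContDiffAt ℝ 2 f p) :
    DifferentiableAt ℝ (angularDeriv f) p :=
  ((hf.fderiv_right (m := 1) (by norm_num)).differentiableAt one_ne_zero).clm_apply
    (differentiableAt_snd.neg.prodMk differentiableAt_fst)

theorem IsGermOfOrder.angularDeriv {m : ℕ} {F : ℝ × ℝ → ℝ} (hF : IsGermOfOrder (m + 1) F) :
    IsGermOfOrder (m + 1) (angularDeriv F) := by
  simp only [funext (angularDeriv_eq F), smul_eq_mul]
  exact add_comm 1 m ▸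
    (IsGermOfOrder.snd.neg.mul (hF.fderiv_apply _)).add (.mul .fst (hF.fderiv_apply _))

theorem IsGermOfOrder.isBigO_polarPt {m : ℕ} {F : ℝ × ℝ → ℝ} (hF : IsGermOfOrder m F) (θ : ℝ) :
    (fun r => F (polarPt r θ)) =O[𝓝[>] 0] fun r : ℝ => r ^ m := by
  refine (hF.isBigO.comp_tendsto (tendsto_polarPt θ)).trans (.of_bound' (.of_forall fun r => ?_))
  simp only [Function.comp_apply, norm_pow, norm_norm]
  gcongr
  exact norm_polarPt_le r θ

end PolarCoordinates

section LeadingForms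

/-- `P` is a leading form of order `m` of the germ `H` at the origin: `P` has order at least `m` and
`H - P` has order at least `m + 1`. In the applications `P` is a homogeneous polynomial of degree
`m`, but homogeneity is not part of the definition, and `P` may be zero. -/
structure HasLeadingForm (m : ℕ) (H P : ℝ × ℝ → ℝ) : Prop where
  germ : IsGermOfOrder m P
  remainder : IsGermOfOrder (m + 1) fun p => H p - P p

variable {m n : ℕ} {H K P Q : ℝ × ℝ → ℝ}

theorem IsGermOfOrder.hasLeadingForm_self (hP : IsGermOfOrder m P) : HasLeadingForm m P P :=
  ⟨hP, by simpa using IsGermOfOrder.zero⟩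

theorem IsGermOfOrder.hasLeadingForm_zero (hH : IsGermOfOrder n H) (hmn : m < n) :
    HasLeadingForm m H fun _ => 0 :=
  ⟨.zero, by simpa using hH.mono hmn⟩

namespace HasLeadingForm

theorem isGermOfOrder (h : HasLeadingForm m H P) : IsGermOfOrder m H := by
  simpa using (h.remainder.mono m.le_succ).add h.germ

theorem congr (h : HasLeadingForm m H P) (hHK : H =ᶠ[𝓝 0] K) (hPQ : ∀ p, P p = Q p) :
    HasLeadingForm m K Q := by
  obtain rfl : P = Q := funext hPQ
  exact ⟨h.germ, h.remainder.congr (hHK.mono fun p hp => by simp only [hp])⟩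

theorem neg (hH : HasLeadingForm m H P) : HasLeadingForm m (fun p => -H p) fun p => -P p :=
  ⟨hH.germ.neg, hH.remainder.neg.congr (.of_forall fun p => by ring)⟩

theorem add (hH : HasLeadingForm m H P) (hK : HasLeadingForm m K Q) :
    HasLeadingForm m (fun p => H p + K p) fun p => P p + Q p :=
  ⟨hH.germ.add hK.germ, (hH.remainder.add hK.remainder).congr (.of_forall fun p => by ring)⟩

theorem sub (hH : HasLeadingForm m H P) (hK : HasLeadingForm m K Q) :
    HasLeadingForm m (fun p => H p - K p) fun p => P p - Q p := by
  simpa only [sub_eq_add_neg] using hH.add hK.neg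

theorem mul (hH : HasLeadingForm m H P) (hK : HasLeadingForm n K Q) :
    HasLeadingForm (m + n) (fun p => H p * K p) fun p => P p * Q p := by
  refine ⟨hH.germ.mul hK.germ, ?_⟩
  have hHK := hH.isGermOfOrder.mul hK.remainder
  have hPK := hH.remainder.mul hK.germ
  rw [← add_assoc] at hHK
  rw [add_right_comm] at hPK
  exact (hHK.add hPK).congr (.of_forall fun p => by ring)

theorem fderiv_apply (h : HasLeadingForm (m + 1) H P) (w : ℝ × ℝ) :
    HasLeadingForm m (fun p => fderiv ℝ H p w) fun p => fderiv ℝ P p w := by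
  refine ⟨h.germ.fderiv_apply w, (h.remainder.fderiv_apply w).congr ?_⟩
  filter_upwards [h.germ.1, h.isGermOfOrder.1] with p hP hH
  rw [fderiv_fun_sub (hH.differentiableAt (by simp)) (hP.differentiableAt (by simp))]
  rfl

theorem angularDeriv (h : HasLeadingForm (m + 1) H P) :
    HasLeadingForm (m + 1) (angularDeriv H) (angularDeriv P) := by
  refine ⟨h.germ.angularDeriv, h.remainder.angularDeriv.congr ?_⟩
  filter_upwards [h.germ.1, h.isGermOfOrder.1] with p hP hH
  rw [_root_.angularDeriv,
    fderiv_fun_sub (hH.differentiableAt (by simp)) (hP.differentiableAt (by simp))]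
  rfl

theorem eventually_ne_zero (h : HasLeadingForm m H P)
    (hP : (fun p : ℝ × ℝ => ‖p‖ ^ m) =O[𝓝 0] P) : ∀ᶠ p in 𝓝[≠] 0, H p ≠ 0 := by
  have hlittle : (fun p => H p - P p) =o[𝓝 0] P := by
    refine h.remainder.isBigO.trans_isLittleO (IsLittleO.trans_isBigO ?_ hP)
    exact (isLittleO_pow_pow m.lt_succ_self).comp_tendsto tendsto_norm_zero
  obtain ⟨C, hC⟩ := hP.bound
  rw [eventually_nhdsWithin_iff]
  filter_upwards [hlittle.bound one_half_pos, hC] with p hhalf hbound hp hH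
  have hP0 : ‖P p‖ = 0 := by
    rw [hH, zero_sub, norm_neg] at hhalf
    linarith [norm_nonneg (P p)]
  rw [hP0, mul_zero, norm_le_zero_iff] at hbound
  exact hp (norm_eq_zero.1 (eq_zero_of_pow_eq_zero hbound))

end HasLeadingForm

variable {ι : Type*} {f : ℝ × ℝ → ι → ℝ} {i : ι}

theorem HasLeadingForm.fderiv_apply_apply (h : HasLeadingForm (m + 1) (f · i) P)
    (hf : ∀ᶠ p in 𝓝 0, DifferentiableAt ℝ f p) (w : ℝ × ℝ) :
    HasLeadingForm m (fun p => fderiv ℝ f p w i) fun p => fderiv ℝ P p w := by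
  refine (h.fderiv_apply w).congr ?_ fun _ => rfl
  filter_upwards [hf] with p hp
  rw [_root_.fderiv_apply hp]
  rfl

theorem HasLeadingForm.angularDeriv_apply [Fintype ι]
    (h : HasLeadingForm (m + 1) (f · i) P) (hf : ∀ᶠ p in 𝓝 0, DifferentiableAt ℝ f p) :
    HasLeadingForm (m + 1) (fun p => _root_.angularDeriv f p i) (_root_.angularDeriv P) := by
  refine h.angularDeriv.congr ?_ fun _ => rfl
  filter_upwards [hf] with p hp
  simp only [_root_.angularDeriv]
  rw [_root_.fderiv_apply hp]
  rfl

end LeadingForms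

theorem abs_sqrt_sub_sqrt_le {x y : ℝ} (hy : 0 < y) : |√x - √y| ≤ |x - y| / √y := by
  rw [le_div_iff₀ (Real.sqrt_pos.2 hy)]
  rcases le_total 0 x with hx | hx
  · calc |√x - √y| * √y ≤ |√x - √y| * (√x + √y) := by
          gcongr
          linarith [Real.sqrt_nonneg x]
      _ = |x - y| := by
          rw [← abs_of_nonneg (add_nonneg (Real.sqrt_nonneg x) (Real.sqrt_nonneg y)), ← abs_mul]
          congr 1
          linear_combination Real.sq_sqrt hx - Real.sq_sqrt hy.le
  · rw [Real.sqrt_eq_zero_of_nonpos hx, zero_sub, abs_neg, abs_of_nonneg (Real.sqrt_nonneg y),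
      Real.mul_self_sqrt hy.le, abs_of_nonpos (by linarith)]
    linarith

section LeadingTerms

/-- `A r = c r ^ m + O(r ^ (m + 1))` as `r → +0`. The coefficient `c` may vanish. -/
def HasLeadingTerm (m : ℕ) (A : ℝ → ℝ) (c : ℝ) : Prop :=
  (fun r => A r - c * r ^ m) =O[𝓝[>] 0] fun r : ℝ => r ^ (m + 1)

theorem HasLeadingForm.hasLeadingTerm {m : ℕ} {H P : ℝ × ℝ → ℝ} (h : HasLeadingForm m H P)
    {c θ : ℝ} (hP : ∀ r, P (polarPt r θ) = c * r ^ m) :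
    HasLeadingTerm m (fun r => H (polarPt r θ)) c :=
  (h.remainder.isBigO_polarPt θ).congr_left fun r => by rw [hP]

theorem isLittleO_pow_pow_nhdsGT {m n : ℕ} (h : m < n) :
    (fun r : ℝ => r ^ n) =o[𝓝[>] 0] fun r : ℝ => r ^ m :=
  (isLittleO_pow_pow h).mono nhdsWithin_le_nhds

namespace HasLeadingTerm

variable {m n : ℕ} {A B : ℝ → ℝ} {c d : ℝ}

theorem congr (hA : HasLeadingTerm m A c) (h : A =ᶠ[𝓝[>] 0] B) : HasLeadingTerm m B c :=
  IsBigO.congr' hA (h.mono fun r hr => by simp only [hr]) .rfl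

theorem not_isLittleO (hA : HasLeadingTerm m A c) (hc : c ≠ 0) :
    ¬A =o[𝓝[>] 0] fun r : ℝ => r ^ m := by
  intro h
  have hlittle : (fun r : ℝ => c * r ^ m) =o[𝓝[>] 0] fun r : ℝ => r ^ m :=
    (h.sub (IsBigO.trans_isLittleO hA (isLittleO_pow_pow_nhdsGT m.lt_succ_self))).congr_left
      fun r => by ring
  refine isLittleO_irrefl (Eventually.frequently ?_) ((isLittleO_const_mul_left_iff hc).1 hlittle)
  filter_upwards [self_mem_nhdsWithin] with r hr using pow_ne_zero m (ne_of_gt hr)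

theorem isBigO (hA : HasLeadingTerm m A c) : A =O[𝓝[>] 0] fun r : ℝ => r ^ m := by
  refine ((IsBigO.trans hA (isLittleO_pow_pow_nhdsGT m.lt_succ_self).isBigO).add
    ((isBigO_refl _ _).const_mul_left c)).congr_left fun r => ?_
  ring

theorem le_of_ne_zero (hc : HasLeadingTerm m A c) (hc0 : c ≠ 0) (hd : HasLeadingTerm n A d) :
    n ≤ m := by
  by_contra! hmn
  exact hc.not_isLittleO hc0 (hd.isBigO.trans_isLittleO (isLittleO_pow_pow_nhdsGT hmn))

theorem eq (hc : HasLeadingTerm m A c) (hd : HasLeadingTerm m A d) : c = d := by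
  by_contra hcd
  have hzero : HasLeadingTerm m (fun _ => 0) (c - d) :=
    (IsBigO.sub hc hd).congr_left fun r => by ring
  exact hzero.not_isLittleO (sub_ne_zero.2 hcd) (isLittleO_zero _ _)

theorem isBigO_pow (hB : HasLeadingTerm n B d) (hd : d ≠ 0) :
    (fun r : ℝ => r ^ n) =O[𝓝[>] 0] B := by
  have hlittle : (fun r => B r - d * r ^ n) =o[𝓝[>] 0] fun r : ℝ => d * r ^ n :=
    (isLittleO_const_mul_right_iff hd).2
      (IsBigO.trans_isLittleO hB (isLittleO_pow_pow_nhdsGT n.lt_succ_self))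
  exact ((isBigO_refl _ _).const_mul_right' (isUnit_iff_ne_zero.2 hd)).trans
    (hlittle.right_isBigO_add.congr_right fun r => by ring)

theorem div (hA : HasLeadingTerm (m + n) A c) (hB : HasLeadingTerm n B d) (hd : d ≠ 0) :
    HasLeadingTerm m (fun r => A r / B r) (c / d) := by
  have hr0 : ∀ᶠ r : ℝ in 𝓝[>] 0, r ≠ 0 := by
    filter_upwards [self_mem_nhdsWithin] with r hr using ne_of_gt hr
  have hB0 : ∀ᶠ r in 𝓝[>] 0, B r ≠ 0 := by
    filter_upwards [(hB.isBigO_pow hd).eq_zero_imp, hr0] with r hBr hr using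
      fun h => pow_ne_zero n hr (hBr h)
  have hnum : (fun r => A r - c / d * r ^ m * B r) =O[𝓝[>] 0] fun r : ℝ => r ^ (m + n + 1) := by
    have hprod := (isBigO_refl (fun r : ℝ => r ^ m) (𝓝[>] 0)).mul hB
    refine (IsBigO.sub hA ((hprod.congr_right fun r => ?_).const_mul_left (c / d))).congr_left
      fun r => ?_
    · ring
    · field_simp
      ring
  have hinv : (fun r => (B r)⁻¹) =O[𝓝[>] 0] fun r : ℝ => (r ^ n)⁻¹ :=
    (hB.isBigO_pow hd).inv_rev (hr0.mono fun r hr h => absurd h (pow_ne_zero n hr))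
  refine (hnum.mul hinv).congr' ?_ ?_
  · filter_upwards [hB0] with r hr
    field_simp
  · filter_upwards [hr0] with r hr
    field_simp
    ring

theorem sqrt (hB : HasLeadingTerm (2 * n) B d) (hd : 0 < d) :
    HasLeadingTerm n (fun r => √(B r)) √d := by
  have hle : (fun r => √(B r) - √d * r ^ n) =O[𝓝[>] 0]
      fun r => (B r - d * r ^ (2 * n)) * (r ^ n)⁻¹ := by
    refine .of_bound (√d)⁻¹ ?_
    filter_upwards [self_mem_nhdsWithin] with r (hr : 0 < r)
    have hsqrt : √d * r ^ n = √(d * r ^ (2 * n)) := by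
      rw [Real.sqrt_mul hd.le, pow_mul', Real.sqrt_sq (by positivity)]
    calc ‖√(B r) - √d * r ^ n‖ = |√(B r) - √(d * r ^ (2 * n))| := by rw [hsqrt, Real.norm_eq_abs]
      _ ≤ |B r - d * r ^ (2 * n)| / √(d * r ^ (2 * n)) := abs_sqrt_sub_sqrt_le (by positivity)
      _ = (√d)⁻¹ * ‖(B r - d * r ^ (2 * n)) * (r ^ n)⁻¹‖ := by
        rw [← hsqrt, norm_mul, norm_inv, Real.norm_of_nonneg (pow_nonneg hr.le n),
          Real.norm_eq_abs]
        field_simp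
  refine hle.trans ((IsBigO.mul hB (isBigO_refl _ _)).congr' .rfl ?_)
  filter_upwards [self_mem_nhdsWithin] with r (hr : 0 < r)
  field_simp
  ring

end HasLeadingTerm

theorem IsFirstTerm.eq_zero_iff {x : ℝ → ℝ → ℝ} {S : Set ℝ} {c d : ℝ → ℝ}
    (hc : IsFirstTerm x S c) (hd : IsFirstTerm x S d) {θ : ℝ} (hθ : θ ∈ S) :
    c θ = 0 ↔ d θ = 0 := by
  obtain ⟨⟨φ, hφ, hcφ⟩, i, x₀, hx₀, hcx⟩ := hc
  obtain ⟨⟨ψ, hψ, hdψ⟩, j, y₀, hy₀, hdy⟩ := hd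
  replace hcx : ∀ θ ∈ S, HasLeadingTerm i (x · θ) (c θ * x₀ θ) := hcx
  replace hdy : ∀ θ ∈ S, HasLeadingTerm j (x · θ) (d θ * y₀ θ) := hdy
  obtain rfl : i = j := le_antisymm
    ((hdy ψ hψ).le_of_ne_zero (mul_ne_zero hdψ (hy₀ ψ hψ)) (hcx ψ hψ))
    ((hcx φ hφ).le_of_ne_zero (mul_ne_zero hcφ (hx₀ φ hφ)) (hdy φ hφ))
  have hcd : c θ * x₀ θ = d θ * y₀ θ := (hcx θ hθ).eq (hdy θ hθ)
  rw [← mul_eq_zero_iff_right (hx₀ θ hθ), hcd, mul_eq_zero_iff_right (hy₀ θ hθ)]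

end LeadingTerms

section VectorCalculus

variable {ι : Type*} [Fintype ι]

theorem sum_dotProduct_smul_of_orthonormal {R : Type*} [CommRing R] [DecidableEq ι]
    {v : ι → ι → R} (hv : ∀ i j, v i ⬝ᵥ v j = (1 : Matrix ι ι R) i j) (w : ι → R) :
    ∑ i, (w ⬝ᵥ v i) • v i = w := by
  have hvv : Matrix.of v * (Matrix.of v)ᵀ = 1 := Matrix.ext hv
  calc ∑ i, (w ⬝ᵥ v i) • v i = (w ᵥ* (Matrix.of v)ᵀ) ᵥ* Matrix.of v :=
        (Matrix.vecMul_eq_sum _ _).symm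
    _ = w := by rw [Matrix.vecMul_vecMul, mul_eq_one_comm.1 hvv, Matrix.vecMul_one]

theorem dotProduct_self_pos {w : ι → ℝ} (hw : w ≠ 0) : 0 < w ⬝ᵥ w := by
  simpa using Matrix.dotProduct_star_self_pos_iff.2 hw

theorem hasDerivAt_dotProduct {x y : ℝ → ι → ℝ} {x' y' : ι → ℝ} {t : ℝ}
    (hx : HasDerivAt x x' t) (hy : HasDerivAt y y' t) :
    HasDerivAt (fun s => x s ⬝ᵥ y s) (x t ⬝ᵥ y' + x' ⬝ᵥ y t) t :=
  (dotProductBilin ℝ ℝ : (ι → ℝ) →ₗ[ℝ] (ι → ℝ) →ₗ[ℝ] ℝ).toContinuousBilinearMap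
    |>.hasDerivAt_of_bilinear (fun _ => hx) fun _ => hy

theorem hasDerivAt_crossProduct {x y : ℝ → Fin 3 → ℝ} {x' y' : Fin 3 → ℝ} {t : ℝ}
    (hx : HasDerivAt x x' t) (hy : HasDerivAt y y' t) :
    HasDerivAt (fun s => x s ⨯₃ y s) (x t ⨯₃ y' + x' ⨯₃ y t) t :=
  crossProduct.toContinuousBilinearMap.hasDerivAt_of_bilinear (fun _ => hx) fun _ => hy

theorem deriv_dotProduct_eq_neg {x y : ℝ → ι → ℝ} {c : ℝ} (hx : Differentiable ℝ x)
    (hy : Differentiable ℝ y) (hxy : ∀ t, x t ⬝ᵥ y t = c) (t : ℝ) :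
    deriv x t ⬝ᵥ y t = -(deriv y t ⬝ᵥ x t) := by
  have hderiv := hasDerivAt_dotProduct (hx t).hasDerivAt (hy t).hasDerivAt
  rw [funext hxy, dotProduct_comm (x t)] at hderiv
  linarith [hderiv.unique (hasDerivAt_const t c)]

/-- The vector `w` divided by its Euclidean length (and `0` if `w = 0`). The type `ι → ℝ` carries
the supremum norm, hence the explicit square root. -/
noncomputable def unitVector (w : ι → ℝ) : ι → ℝ := (√(w ⬝ᵥ w))⁻¹ • w

theorem unitVector_dotProduct_self {w : ι → ℝ} (hw : w ≠ 0) :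
    unitVector w ⬝ᵥ unitVector w = 1 := by
  have hpos := dotProduct_self_pos hw
  rw [unitVector, smul_dotProduct, dotProduct_smul, smul_smul, smul_eq_mul, ← mul_inv,
    Real.mul_self_sqrt hpos.le, inv_mul_cancel₀ hpos.ne']

theorem sqrt_smul_unitVector {w : ι → ℝ} (hw : w ≠ 0) : √(w ⬝ᵥ w) • unitVector w = w :=
  smul_inv_smul₀ (Real.sqrt_ne_zero'.2 (dotProduct_self_pos hw)) w

theorem differentiable_unitVector {w : ℝ → ι → ℝ} (hw : Differentiable ℝ w)
    (h0 : ∀ t, w t ≠ 0) : Differentiable ℝ fun t => unitVector (w t) := by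
  intro t
  have hpos := dotProduct_self_pos (h0 t)
  have hdot := (hasDerivAt_dotProduct (hw t).hasDerivAt (hw t).hasDerivAt).differentiableAt
  exact ((hdot.sqrt hpos.ne').inv (Real.sqrt_ne_zero'.2 hpos)).smul (hw t)

end VectorCalculus

section Frames

theorem IsFrenetFrame.of_orthonormal {γ e n : ℝ → Fin 3 → ℝ} {l : ℝ → ℝ}
    (hγ : ∀ t, HasDerivAt γ (l t • e t) t) (he : Differentiable ℝ e) (hn : Differentiable ℝ n)
    (hee : ∀ t, e t ⬝ᵥ e t = 1) (hnn : ∀ t, n t ⬝ᵥ n t = 1) (hen : ∀ t, e t ⬝ᵥ n t = 0) :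
    IsFrenetFrame γ l e (fun t => -(e t ⨯₃ n t)) n (fun t => deriv e t ⬝ᵥ -(e t ⨯₃ n t))
      (fun t => deriv e t ⬝ᵥ n t) fun t => deriv (fun t => -(e t ⨯₃ n t)) t ⬝ᵥ n t := by
  set b : ℝ → Fin 3 → ℝ := fun t => -(e t ⨯₃ n t) with hb_def
  have hb : Differentiable ℝ b := fun t =>
    (hasDerivAt_crossProduct (he t).hasDerivAt (hn t).hasDerivAt).differentiableAt.neg
  have hne t : n t ⬝ᵥ e t = 0 := by rw [dotProduct_comm, hen]
  have hbb t : b t ⬝ᵥ b t = 1 := by simp [hb_def, cross_dot_cross, hee, hnn, hen]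
  have heb t : e t ⬝ᵥ b t = 0 := by simp [hb_def]
  have hnb t : n t ⬝ᵥ b t = 0 := by simp [hb_def]
  have hbe t : b t ⬝ᵥ e t = 0 := by rw [dotProduct_comm, heb]
  have hbn t : b t ⬝ᵥ n t = 0 := by rw [dotProduct_comm, hnb]
  have expand t (w : Fin 3 → ℝ) :
      w = (w ⬝ᵥ e t) • e t + (w ⬝ᵥ b t) • b t + (w ⬝ᵥ n t) • n t := by
    have hsum := sum_dotProduct_smul_of_orthonormal (v := ![e t, b t, n t]) (fun i j => by
      fin_cases i <;> fin_cases j <;> simp [hee, hbb, hnn, hen, hne, heb, hbe, hnb, hbn]) w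
    simpa [Fin.sum_univ_three] using hsum.symm
  refine ⟨hγ, hee, hnn, hen, fun t => rfl, fun t => (he t).hasDerivAt.congr_deriv ?_,
    fun t => (hb t).hasDerivAt.congr_deriv ?_, fun t => (hn t).hasDerivAt.congr_deriv ?_⟩
  · have hself := deriv_dotProduct_eq_neg he he hee t
    conv_lhs => rw [expand t (deriv e t), self_eq_neg.1 hself, zero_smul, zero_add]
  · have hself := deriv_dotProduct_eq_neg hb hb hbb t
    conv_lhs => rw [expand t (deriv b t), self_eq_neg.1 hself, zero_smul, add_zero,
      deriv_dotProduct_eq_neg hb he hbe t]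
  · have hself := deriv_dotProduct_eq_neg hn hn hnn t
    conv_lhs => rw [expand t (deriv n t), self_eq_neg.1 hself, zero_smul, add_zero,
      deriv_dotProduct_eq_neg hn he hne t, deriv_dotProduct_eq_neg hn hb hnb t,
      neg_smul (deriv b t ⬝ᵥ n t), ← sub_eq_add_neg]

variable {f : ℝ × ℝ → Fin 3 → ℝ} {p : ℝ × ℝ}

theorem angularDeriv_dotProduct_normalVec (f : ℝ × ℝ → Fin 3 → ℝ) (p : ℝ × ℝ) :
    angularDeriv f p ⬝ᵥ normalVec f p = 0 := by
  simp [angularDeriv_eq, normalVec]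

theorem angularDeriv_ne_zero (hp : p ≠ 0) (hN : normalVec f p ≠ 0) : angularDeriv f p ≠ 0 := by
  intro hT
  rw [angularDeriv_eq] at hT
  have hu : fderiv ℝ f p (1, 0) ⨯₃ (-p.2 • fderiv ℝ f p (1, 0) + p.1 • fderiv ℝ f p (0, 1))
      = p.1 • normalVec f p := by simp [normalVec]
  have hv : (-p.2 • fderiv ℝ f p (1, 0) + p.1 • fderiv ℝ f p (0, 1)) ⨯₃ fderiv ℝ f p (0, 1)
      = -p.2 • normalVec f p := by simp [normalVec]
  rw [hT, map_zero, eq_comm, smul_eq_zero_iff_left hN] at hu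
  rw [hT, map_zero, LinearMap.zero_apply, eq_comm, smul_eq_zero_iff_left hN, neg_eq_zero] at hv
  exact hp (Prod.ext hu hv)

theorem differentiableAt_normalVec (hf : ContDiffAt ℝ 2 f p) :
    DifferentiableAt ℝ (normalVec f) p := by
  have hu := differentiableAt_fderiv_apply hf (1, 0)
  have hv := differentiableAt_fderiv_apply hf (0, 1)
  exact (crossProduct.toContinuousBilinearMap.hasFDerivAt_of_bilinear hu.hasFDerivAt
    hv.hasFDerivAt).differentiableAt

theorem exists_isConormalFrame {r : ℝ} (hr : r ≠ 0) (hf : ∀ θ, ContDiffAt ℝ 2 f (polarPt r θ))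
    (hN : ∀ θ, normalVec f (polarPt r θ) ≠ 0) :
    ∃ (l : ℝ → ℝ) (e b n : ℝ → Fin 3 → ℝ) (κ₁ κ₂ κ₃ : ℝ → ℝ),
      IsConormalFrame f r l e b n κ₁ κ₂ κ₃ := by
  have hT0 θ : angularDeriv f (polarPt r θ) ≠ 0 :=
    angularDeriv_ne_zero (polarPt_ne_zero hr θ) (hN θ)
  have hT : Differentiable ℝ fun θ => angularDeriv f (polarPt r θ) := fun θ =>
    (hasDerivAt_comp_polarPt (differentiableAt_angularDeriv (hf θ))).differentiableAt
  have hN' : Differentiable ℝ fun θ => normalVec f (polarPt r θ) := fun θ =>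
    (hasDerivAt_comp_polarPt (differentiableAt_normalVec (hf θ))).differentiableAt
  have he := differentiable_unitVector hT hT0
  have hν : Differentiable ℝ fun θ => unitNormal f (polarPt r θ) :=
    differentiable_unitVector hN' hN
  have hn : Differentiable ℝ fun θ =>
      -(unitVector (angularDeriv f (polarPt r θ)) ⨯₃ unitNormal f (polarPt r θ)) := fun θ =>
    (hasDerivAt_crossProduct (he θ).hasDerivAt (hν θ).hasDerivAt).differentiableAt.neg
  have hνν θ : unitNormal f (polarPt r θ) ⬝ᵥ unitNormal f (polarPt r θ) = 1 :=
    unitVector_dotProduct_self (hN θ)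
  have heν θ : unitVector (angularDeriv f (polarPt r θ)) ⬝ᵥ unitNormal f (polarPt r θ) = 0 := by
    simp [unitVector, unitNormal, angularDeriv_dotProduct_normalVec]
  refine ⟨_, _, _, _, _, _, _, .of_orthonormal
    (l := fun θ => √(angularDeriv f (polarPt r θ) ⬝ᵥ angularDeriv f (polarPt r θ)))
    (fun θ => ?_) he hn (fun θ => unitVector_dotProduct_self (hT0 θ)) (fun θ => ?_) (fun θ => ?_),
    fun θ => rfl⟩
  · rw [sqrt_smul_unitVector (hT0 θ)]
    exact hasDerivAt_comp_polarPt ((hf θ).differentiableAt (by norm_num))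
  · simp [cross_dot_cross, unitVector_dotProduct_self (hT0 θ), hνν, heν]
  · simp

variable {r θ : ℝ} {l : ℝ → ℝ} {e b n : ℝ → Fin 3 → ℝ} {κ₁ κ₂ κ₃ : ℝ → ℝ}

theorem IsFrenetFrame.dotProduct_normal_eq {γ T : ℝ → Fin 3 → ℝ} {X : Fin 3 → ℝ} {t : ℝ}
    (h : IsFrenetFrame γ l e b n κ₁ κ₂ κ₃) (hT : ∀ s, HasDerivAt γ (T s) s)
    (hX : HasDerivAt T X t) : X ⬝ᵥ n t = l t * κ₂ t := by
  have hTl s : T s = l s • e s := (hT s).unique (h.tangent s)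
  have hTn : (fun s => T s ⬝ᵥ n s) = fun _ => 0 := funext fun s => by simp [hTl, h.orth]
  have hderiv := hasDerivAt_dotProduct hX (h.deriv_n t)
  rw [hTn] at hderiv
  have hsum := hderiv.unique (hasDerivAt_const t 0)
  simp only [hTl, h.b_eq, dotProduct_sub, dotProduct_smul, smul_dotProduct, dotProduct_neg,
    dot_self_cross, h.unit_e, smul_eq_mul] at hsum
  linear_combination hsum

theorem IsConormalFrame.kappa_two_eq (h : IsConormalFrame f r l e b n κ₁ κ₂ κ₃)
    (hf : ∀ t, ContDiffAt ℝ 2 f (polarPt r t)) (hT : angularDeriv f (polarPt r θ) ≠ 0) :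
    κ₂ θ = -(angularDeriv (angularDeriv f) (polarPt r θ) ⬝ᵥ
        angularDeriv f (polarPt r θ) ⨯₃ normalVec f (polarPt r θ)) /
      ((angularDeriv f (polarPt r θ) ⬝ᵥ angularDeriv f (polarPt r θ)) *
        √(normalVec f (polarPt r θ) ⬝ᵥ normalVec f (polarPt r θ))) := by
  obtain ⟨hframe, hn⟩ := h
  have hderiv t := hasDerivAt_comp_polarPt ((hf t).differentiableAt (by norm_num))
  have hXn := hframe.dotProduct_normal_eq hderiv
    (hasDerivAt_comp_polarPt (differentiableAt_angularDeriv (hf θ)))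
  have hTl : angularDeriv f (polarPt r θ) = l θ • e θ := (hderiv θ).unique (hframe.tangent θ)
  have hl : l θ ≠ 0 := fun h0 => hT (by rw [hTl, h0, zero_smul])
  rw [hn θ, unitNormal, map_smul, dotProduct_neg, dotProduct_smul, smul_eq_mul] at hXn
  simp only [hTl, map_smul, LinearMap.smul_apply, dotProduct_smul, smul_dotProduct, smul_eq_mul,
    hframe.unit_e]
  rw [eq_comm, mul_one, div_eq_mul_inv, mul_inv, mul_inv, ← mul_right_inj' hl, ← hXn]
  field_simp

end Frames

section LowDegreeForms

/-- The linear form `a u + b v`. -/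
def linForm (a b : ℝ) (p : ℝ × ℝ) : ℝ := a * p.1 + b * p.2

/-- The quadratic form with Hessian matrix `(α, β; β, γ)`, that is, the degree two part of a Taylor
expansion with second derivatives `α, β, γ`. -/
noncomputable def quadForm (α β γ : ℝ) (p : ℝ × ℝ) : ℝ :=
  α / 2 * p.1 ^ 2 + β * (p.1 * p.2) + γ / 2 * p.2 ^ 2

variable {a b α β γ : ℝ}

theorem isGermOfOrder_linForm : IsGermOfOrder 1 (linForm a b) :=
  (IsGermOfOrder.fst.const_mul a).add (IsGermOfOrder.snd.const_mul b)

theorem isGermOfOrder_quadForm : IsGermOfOrder 2 (quadForm α β γ) :=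
  (((IsGermOfOrder.fst.pow 2).const_mul (α / 2)).add ((IsGermOfOrder.fst.mul .snd).const_mul β)).add
    ((IsGermOfOrder.snd.pow 2).const_mul (γ / 2))

theorem fderiv_linForm (p w : ℝ × ℝ) : fderiv ℝ (linForm a b) p w = linForm a b w := by
  have hu : HasFDerivAt (fun q : ℝ × ℝ => q.1) (ContinuousLinearMap.fst ℝ ℝ ℝ) p := hasFDerivAt_fst
  have hv : HasFDerivAt (fun q : ℝ × ℝ => q.2) (ContinuousLinearMap.snd ℝ ℝ ℝ) p := hasFDerivAt_snd
  have h : HasFDerivAt (linForm a b) _ p := (hu.const_mul a).add (hv.const_mul b)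
  rw [h.fderiv]
  simp [linForm]

theorem fderiv_quadForm (p w : ℝ × ℝ) :
    fderiv ℝ (quadForm α β γ) p w = linForm (α * w.1 + β * w.2) (β * w.1 + γ * w.2) p := by
  have hu : HasFDerivAt (fun q : ℝ × ℝ => q.1) (ContinuousLinearMap.fst ℝ ℝ ℝ) p := hasFDerivAt_fst
  have hv : HasFDerivAt (fun q : ℝ × ℝ => q.2) (ContinuousLinearMap.snd ℝ ℝ ℝ) p := hasFDerivAt_snd
  have h : HasFDerivAt (quadForm α β γ) _ p := (((hu.pow 2).const_mul (α / 2)).add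
    ((hu.mul hv).const_mul β)).add ((hv.pow 2).const_mul (γ / 2))
  rw [h.fderiv]
  simp only [Nat.add_one_sub_one, pow_one, nsmul_eq_mul, Nat.cast_ofNat, smul_add,
    add_apply, smul_apply, ContinuousLinearMap.coe_fst', ContinuousLinearMap.coe_snd', smul_eq_mul,
    linForm]
  ring

theorem angularDeriv_linForm : angularDeriv (linForm a b) = linForm b (-a) := by
  funext p
  simp only [angularDeriv, fderiv_linForm, linForm]
  ring

theorem angularDeriv_quadForm :
    angularDeriv (quadForm α β γ) = quadForm (2 * β) (γ - α) (-(2 * β)) := by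
  funext p
  simp only [angularDeriv, fderiv_quadForm, quadForm, linForm]
  ring

end LowDegreeForms

section QuarticForm

/-- The homogenization of `quarticG`, a binary quartic form in `(u, v)`. -/
def quarticForm (α β γ : ℝ) (p : ℝ × ℝ) : ℝ :=
  (β ^ 2 + 1) * p.1 ^ 4 + β * γ * p.1 ^ 3 * p.2 + 3 * (β ^ 2 + 1) * p.1 ^ 2 * p.2 ^ 2
    + β * (4 * γ - α) * p.1 * p.2 ^ 3 + γ * (γ - α) * p.2 ^ 4

theorem quarticForm_polarPt (α β γ r : ℝ) {θ : ℝ} (hθ : Real.sin θ ≠ 0) :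
    quarticForm α β γ (polarPt r θ) =
      Real.sin θ ^ 4 * quarticG α β γ (Real.cos θ / Real.sin θ) * r ^ 4 := by
  simp only [quarticForm, quarticG, polarPt]
  field_simp

theorem exists_cos_div_sin_eq (s : ℝ) :
    ∃ θ, Real.sin θ ≠ 0 ∧ Real.cos θ / Real.sin θ = s := by
  refine ⟨Real.pi / 2 - Real.arctan s, ?_, ?_⟩
  · rw [Real.sin_pi_div_two_sub]
    exact (Real.cos_arctan_pos s).ne'
  · rw [Real.sin_pi_div_two_sub, Real.cos_pi_div_two_sub, ← Real.tan_eq_sin_div_cos,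
      Real.tan_arctan]

theorem exists_quarticG_ne_zero (α β γ : ℝ) : ∃ s, quarticG α β γ s ≠ 0 := by
  by_contra! h
  -- The fourth difference of a quartic is `4!` times its leading coefficient.
  have hlead : 24 * (β ^ 2 + 1) = 0 := by
    have hdiff : quarticG α β γ 2 - 4 * quarticG α β γ 1 + 6 * quarticG α β γ 0
        - 4 * quarticG α β γ (-1) + quarticG α β γ (-2) = 24 * (β ^ 2 + 1) := by
      simp only [quarticG]
      ring
    simpa [h] using hdiff.symm
  nlinarith [sq_nonneg β]

end QuarticForm

section NormalForm

/-- The leading form of `|f_u × f_v| ^ 2` for an umbrella `f` with second derivatives `α, β, γ` of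
its third coordinate (it does not depend on `α`). -/
def normalSqForm (β γ : ℝ) (p : ℝ × ℝ) : ℝ := linForm 1 0 p ^ 2 + linForm β γ p ^ 2

theorem normalSqForm_polarPt (β γ r θ : ℝ) :
    normalSqForm β γ (polarPt r θ) = normalSqForm β γ (polarPt 1 θ) * r ^ 2 := by
  simp only [normalSqForm, linForm, polarPt]
  ring

theorem norm_sq_le_mul_normalSqForm (β : ℝ) {γ : ℝ} (hγ : γ ≠ 0) (p : ℝ × ℝ) :
    ‖p‖ ^ 2 ≤ (1 + 2 * (1 + β ^ 2) / γ ^ 2) * normalSqForm β γ p := by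
  have hQ : normalSqForm β γ p = p.1 ^ 2 + (β * p.1 + γ * p.2) ^ 2 := by
    simp only [normalSqForm, linForm]
    ring
  have hu : p.1 ^ 2 ≤ normalSqForm β γ p := by
    rw [hQ]
    exact le_add_of_nonneg_right (sq_nonneg _)
  have hv : p.2 ^ 2 ≤ 2 * (1 + β ^ 2) / γ ^ 2 * normalSqForm β γ p := by
    rw [div_mul_eq_mul_div, le_div_iff₀ (by positivity), hQ]
    nlinarith [sq_nonneg (2 * β * p.1 + γ * p.2), sq_nonneg p.1,
      sq_nonneg (β * (β * p.1 + γ * p.2))]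
  have hp : ‖p‖ ^ 2 ≤ p.1 ^ 2 + p.2 ^ 2 := by
    rcases max_choice ‖p.1‖ ‖p.2‖ with h | h <;> rw [Prod.norm_def, h, Real.norm_eq_abs, sq_abs]
    · exact le_add_of_nonneg_right (sq_nonneg _)
    · exact le_add_of_nonneg_left (sq_nonneg _)
  linarith

theorem normalSqForm_pos (β : ℝ) {γ : ℝ} (hγ : γ ≠ 0) {p : ℝ × ℝ} (hp : p ≠ 0) :
    0 < normalSqForm β γ p := by
  have hnorm : 0 < ‖p‖ ^ 2 := pow_pos (norm_pos_iff.2 hp) 2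
  exact pos_of_mul_pos_right (hnorm.trans_le (norm_sq_le_mul_normalSqForm β hγ p)) (by positivity)

end NormalForm

section Umbrella

/-- The coordinates of `f` are `u`, `u v` and `α u ^ 2 / 2 + β u v + γ v ^ 2 / 2` up to smooth germs
of orders `2`, `3` and `3`. Only these leading forms of a Whitney umbrella enter the first term of
`κ₂`. -/
structure HasUmbrellaJet (α β γ : ℝ) (f : ℝ × ℝ → Fin 3 → ℝ) : Prop where
  zero : HasLeadingForm 1 (f · 0) (linForm 1 0)
  one : HasLeadingForm 2 (f · 1) (quadForm 0 1 0)
  two : HasLeadingForm 2 (f · 2) (quadForm α β γ)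

theorem hasUmbrellaJet_whitneyNormalForm {k : ℕ} (hk : 2 ≤ k) (a : ℕ → ℕ → ℝ) (b : ℕ → ℝ)
    {R₁ R₂ : ℝ × ℝ → ℝ} (hR₁ : IsGermOfOrder 3 R₁) (hR₂ : IsGermOfOrder 3 R₂) :
    HasUmbrellaJet (a 2 0) (a 1 1) (a 0 2) (whitneyNormalForm k a b R₁ R₂) where
  zero := isGermOfOrder_linForm.hasLeadingForm_self.congr
    (.of_forall fun p => by simp [linForm, whitneyNormalForm]) fun _ => rfl
  one := by
    refine ⟨isGermOfOrder_quadForm, ((IsGermOfOrder.sum (Finset.Icc 3 k) fun i hi =>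
      ((IsGermOfOrder.snd.pow i).mono ?_).const_mul (b i / i.factorial)).add hR₁).congr
        (.of_forall fun p => ?_)⟩
    · simpa using (Finset.mem_Icc.1 hi).1
    · simp only [whitneyNormalForm, quadForm, Matrix.cons_val_one, Matrix.cons_val_zero]
      ring
  two := by
    refine ⟨isGermOfOrder_quadForm, ((IsGermOfOrder.sum (Finset.Icc 3 k) fun j hj =>
      .sum (Finset.HasAntidiagonal.antidiagonal j) fun q hq =>
        (((IsGermOfOrder.fst.pow q.1).mul (IsGermOfOrder.snd.pow q.2)).mono ?_).const_mul
          (a q.1 q.2 / (q.1.factorial * q.2.factorial))).add hR₂).congr (.of_forall fun p => ?_)⟩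
    · rw [Finset.HasAntidiagonal.mem_antidiagonal] at hq
      rw [Finset.mem_Icc] at hj
      omega
    · have hquad : ∑ q ∈ Finset.HasAntidiagonal.antidiagonal 2, a q.1 q.2 /
          (q.1.factorial * q.2.factorial) * (p.1 ^ q.1 * p.2 ^ q.2) =
            quadForm (a 2 0) (a 1 1) (a 0 2) p := by
        simp only [Finset.Nat.sum_antidiagonal_eq_sum_range_succ_mk, Finset.sum_range_succ,
          Finset.sum_range_zero, Nat.factorial, quadForm]
        push_cast
        ring
      have hIcc : Finset.Icc 2 k = insert 2 (Finset.Icc 3 k) :=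
        (Finset.insert_Icc_succ_left_eq_Icc hk).symm
      simp only [whitneyNormalForm, Matrix.cons_val]
      rw [← hquad, hIcc, Finset.sum_insert (by simp)]
      simp only [mul_assoc]
      ring

namespace HasUmbrellaJet

variable {α β γ : ℝ} {f : ℝ × ℝ → Fin 3 → ℝ}

theorem eventually_contDiffAt (hf : HasUmbrellaJet α β γ f) :
    ∀ᶠ p in 𝓝 0, ContDiffAt ℝ 2 f p := by
  filter_upwards [hf.zero.isGermOfOrder.1, hf.one.isGermOfOrder.1, hf.two.isGermOfOrder.1]
    with p h₀ h₁ h₂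
  rw [contDiffAt_pi]
  intro i
  fin_cases i
  · exact contDiffAt_infty.1 h₀ 2
  · exact contDiffAt_infty.1 h₁ 2
  · exact contDiffAt_infty.1 h₂ 2

theorem eventually_differentiableAt (hf : HasUmbrellaJet α β γ f) :
    ∀ᶠ p in 𝓝 0, DifferentiableAt ℝ f p :=
  hf.eventually_contDiffAt.mono fun _ hp => hp.differentiableAt two_ne_zero

theorem angularDeriv_leadingForms (hf : HasUmbrellaJet α β γ f) :
    HasLeadingForm 1 (angularDeriv f · 0) (linForm 0 (-1)) ∧
      HasLeadingForm 2 (angularDeriv f · 1) (quadForm 2 0 (-2)) ∧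
      HasLeadingForm 2 (angularDeriv f · 2) (quadForm (2 * β) (γ - α) (-(2 * β))) := by
  have hdiff := hf.eventually_differentiableAt
  refine ⟨?_, ?_, ?_⟩
  · simpa [angularDeriv_linForm] using hf.zero.angularDeriv_apply hdiff
  · simpa [angularDeriv_quadForm] using hf.one.angularDeriv_apply hdiff
  · simpa [angularDeriv_quadForm] using hf.two.angularDeriv_apply hdiff

theorem angularDeriv_angularDeriv_leadingForms (hf : HasUmbrellaJet α β γ f) :
    HasLeadingForm 1 (angularDeriv (angularDeriv f) · 0) (linForm (-1) 0) ∧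
      HasLeadingForm 2 (angularDeriv (angularDeriv f) · 1) (quadForm 0 (-4) 0) ∧
      HasLeadingForm 2 (angularDeriv (angularDeriv f) · 2)
        (quadForm (2 * (γ - α)) (-(4 * β)) (-(2 * (γ - α)))) := by
  have hdiff : ∀ᶠ p in 𝓝 0, DifferentiableAt ℝ (angularDeriv f) p :=
    hf.eventually_contDiffAt.mono fun _ hp => differentiableAt_angularDeriv hp
  obtain ⟨h₀, h₁, h₂⟩ := hf.angularDeriv_leadingForms
  refine ⟨(h₀.angularDeriv_apply hdiff).congr .rfl ?_, (h₁.angularDeriv_apply hdiff).congr .rfl ?_,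
    (h₂.angularDeriv_apply hdiff).congr .rfl ?_⟩ <;> intro p
  · rw [angularDeriv_linForm, neg_zero]
  · rw [angularDeriv_quadForm]
    norm_num
  · rw [angularDeriv_quadForm]
    congr 1
    ring

theorem normalVec_leadingForms (hf : HasUmbrellaJet α β γ f) :
    IsGermOfOrder 2 (normalVec f · 0) ∧
      HasLeadingForm 1 (normalVec f · 1) (linForm (-β) (-γ)) ∧
      HasLeadingForm 1 (normalVec f · 2) (linForm 1 0) := by
  have hdiff := hf.eventually_differentiableAt
  have h₀ := hf.zero.fderiv_apply_apply (m := 0) hdiff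
  have h₁ := hf.one.fderiv_apply_apply hdiff
  have h₂ := hf.two.fderiv_apply_apply hdiff
  refine ⟨?_, ?_, ?_⟩
  · exact (((h₁ (1, 0)).mul (h₂ (0, 1))).sub ((h₂ (1, 0)).mul (h₁ (0, 1)))).isGermOfOrder
  · refine (((h₂ (1, 0)).mul (h₀ (0, 1))).sub
      (add_comm 0 1 ▸ (h₀ (1, 0)).mul (h₂ (0, 1)))).congr .rfl fun p => ?_
    simp only [fderiv_linForm, fderiv_quadForm, linForm]
    ring
  · refine ((add_comm 0 1 ▸ (h₀ (1, 0)).mul (h₁ (0, 1))).sub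
      ((h₁ (1, 0)).mul (h₀ (0, 1)))).congr .rfl fun p => ?_
    simp only [fderiv_linForm, fderiv_quadForm, linForm]
    ring

theorem normalVec_sq_leadingForm (hf : HasUmbrellaJet α β γ f) :
    HasLeadingForm 2 (fun p => normalVec f p ⬝ᵥ normalVec f p) (normalSqForm β γ) := by
  obtain ⟨h₀, h₁, h₂⟩ := hf.normalVec_leadingForms
  refine ((((h₀.mul h₀).hasLeadingForm_zero (by norm_num)).add (h₁.mul h₁)).add
    (h₂.mul h₂)).congr (.of_forall fun p => (Matrix.vec3_dotProduct _ _).symm) fun p => ?_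
  simp only [normalSqForm, linForm]
  ring

theorem eventually_normalVec_ne_zero (hf : HasUmbrellaJet α β γ f) (hγ : γ ≠ 0) :
    ∀ᶠ p in 𝓝[≠] 0, normalVec f p ≠ 0 := by
  have hcoercive : (fun p : ℝ × ℝ => ‖p‖ ^ 2) =O[𝓝 0] normalSqForm β γ :=
    .of_bound _ (.of_forall fun p => by
      simpa using (norm_sq_le_mul_normalSqForm β hγ p).trans
        (mul_le_mul_of_nonneg_left (le_abs_self _) (by positivity)))
  filter_upwards [hf.normalVec_sq_leadingForm.eventually_ne_zero hcoercive] with p hp h0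
  simp [h0] at hp

theorem angularDeriv_sq_leadingForm (hf : HasUmbrellaJet α β γ f) :
    HasLeadingForm 2 (fun p => angularDeriv f p ⬝ᵥ angularDeriv f p) fun p => p.2 ^ 2 := by
  obtain ⟨h₀, h₁, h₂⟩ := hf.angularDeriv_leadingForms
  refine (((h₀.mul h₀).add ((h₁.mul h₁).isGermOfOrder.hasLeadingForm_zero (by norm_num))).add
    ((h₂.mul h₂).isGermOfOrder.hasLeadingForm_zero (by norm_num))).congr
    (.of_forall fun p => (Matrix.vec3_dotProduct _ _).symm) fun p => ?_
  simp only [linForm]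
  ring

theorem tripleProduct_leadingForm (hf : HasUmbrellaJet α β γ f) :
    HasLeadingForm 4
      (fun p => -(angularDeriv (angularDeriv f) p ⬝ᵥ angularDeriv f p ⨯₃ normalVec f p))
      (quarticForm α β γ) := by
  obtain ⟨hX₀, hX₁, hX₂⟩ := hf.angularDeriv_angularDeriv_leadingForms
  obtain ⟨hT₀, hT₁, hT₂⟩ := hf.angularDeriv_leadingForms
  obtain ⟨hN₀, hN₁, hN₂⟩ := hf.normalVec_leadingForms
  have hTN₀ := (hT₁.mul hN₂).sub (hT₂.mul hN₁)
  have hTN₁ := ((hT₂.isGermOfOrder.mul hN₀).hasLeadingForm_zero (by norm_num)).sub (hT₀.mul hN₂)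
  have hTN₂ := (hT₀.mul hN₁).sub ((hT₁.isGermOfOrder.mul hN₀).hasLeadingForm_zero (by norm_num))
  refine (((add_comm 1 3 ▸ hX₀.mul hTN₀).add (hX₁.mul hTN₁)).add (hX₂.mul hTN₂)).neg.congr
    (.of_forall fun p => ?_) fun p => ?_
  · simp only [cross_apply, Matrix.vec3_dotProduct]
    rfl
  · simp only [linForm, quadForm, quarticForm]
    ring

theorem hasLeadingTerm_kappa_two (hf : HasUmbrellaJet α β γ f) (hγ : γ ≠ 0)
    {l : ℝ → ℝ → ℝ} {e b n : ℝ → ℝ → Fin 3 → ℝ} {κ₁ κ₂ κ₃ : ℝ → ℝ → ℝ}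
    (h : ∀ᶠ r in 𝓝[>] 0, IsConormalFrame f r (l r) (e r) (b r) (n r) (κ₁ r) (κ₂ r) (κ₃ r))
    {θ : ℝ} (hθ : Real.sin θ ≠ 0) :
    HasLeadingTerm 1 (κ₂ · θ) (quarticG α β γ (Real.cos θ / Real.sin θ) *
      (Real.sin θ ^ 2 / √(normalSqForm β γ (polarPt 1 θ)))) := by
  have hQ := normalSqForm_pos β hγ (polarPt_ne_zero one_ne_zero θ)
  have hnum := hf.tripleProduct_leadingForm.hasLeadingTerm
    fun r => quarticForm_polarPt α β γ r hθ
  have hT := hf.angularDeriv_sq_leadingForm.hasLeadingTerm (c := Real.sin θ ^ 2) (θ := θ)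
    fun r => by simp only [polarPt]; ring
  have hN := (hf.normalVec_sq_leadingForm.hasLeadingTerm
    fun r => normalSqForm_polarPt β γ r θ).sqrt (n := 1) hQ
  have hquot := (HasLeadingTerm.div (m := 2) hnum hT (pow_ne_zero 2 hθ)).div (m := 1) hN
    (Real.sqrt_ne_zero'.2 hQ)
  have hcoeff : Real.sin θ ^ 4 * quarticG α β γ (Real.cos θ / Real.sin θ) / Real.sin θ ^ 2 /
      √(normalSqForm β γ (polarPt 1 θ)) = quarticG α β γ (Real.cos θ / Real.sin θ) *
        (Real.sin θ ^ 2 / √(normalSqForm β γ (polarPt 1 θ))) := by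
    field_simp
  rw [hcoeff] at hquot
  refine hquot.congr ?_
  filter_upwards [h, self_mem_nhdsWithin, eventually_forall_polarPt
      (hf.eventually_contDiffAt.filter_mono nhdsWithin_le_nhds),
    eventually_forall_polarPt (hf.eventually_normalVec_ne_zero hγ)] with r hframe hr hsmooth hN
  rw [hframe.kappa_two_eq hsmooth
    (angularDeriv_ne_zero (polarPt_ne_zero (ne_of_gt hr) θ) (hN θ)), div_div]

theorem eventually_exists_isConormalFrame (hf : HasUmbrellaJet α β γ f) (hγ : γ ≠ 0) :
    ∀ᶠ r in 𝓝[>] 0, ∃ (l : ℝ → ℝ) (e b n : ℝ → Fin 3 → ℝ) (κ₁ κ₂ κ₃ : ℝ → ℝ),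
      IsConormalFrame f r l e b n κ₁ κ₂ κ₃ := by
  filter_upwards [self_mem_nhdsWithin, eventually_forall_polarPt
      (hf.eventually_contDiffAt.filter_mono nhdsWithin_le_nhds),
    eventually_forall_polarPt (hf.eventually_normalVec_ne_zero hγ)] with r hr hsmooth hN
  exact exists_isConormalFrame (ne_of_gt hr) hsmooth hN

end HasUmbrellaJet

end Umbrella

theorem mainTheorem7_general {α β γ : ℝ} {f : ℝ × ℝ → Fin 3 → ℝ} (hγ : γ ≠ 0)
    (hf : HasUmbrellaJet α β γ f) :
    (∃ ρ : ℝ, 0 < ρ ∧ ∀ r : ℝ, 0 < r → r < ρ →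
      ∃ (l : ℝ → ℝ) (e b n : ℝ → Fin 3 → ℝ) (κ₁ κ₂ κ₃ : ℝ → ℝ),
        IsConormalFrame f r l e b n κ₁ κ₂ κ₃) ∧
    ∀ (ρ : ℝ) (l : ℝ → ℝ → ℝ) (e b n : ℝ → ℝ → Fin 3 → ℝ) (κ₁ κ₂ κ₃ : ℝ → ℝ → ℝ), 0 < ρ →
      (∀ r : ℝ, 0 < r → r < ρ →
        IsConormalFrame f r (l r) (e r) (b r) (n r) (κ₁ r) (κ₂ r) (κ₃ r)) →
      (∃ c : ℝ → ℝ, IsFirstTerm κ₂ {θ | Real.sin θ ≠ 0} c) ∧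
      ∀ c : ℝ → ℝ, IsFirstTerm κ₂ {θ | Real.sin θ ≠ 0} c →
        ∀ θ : ℝ, Real.sin θ ≠ 0 →
          (c θ = 0 ↔ quarticG α β γ (Real.cos θ / Real.sin θ) = 0) := by
  constructor
  · obtain ⟨ρ, hρ, hframe⟩ := mem_nhdsGT_iff_exists_Ioo_subset.1
      (hf.eventually_exists_isConormalFrame hγ)
    exact ⟨ρ, hρ, fun r hr hrρ => hframe ⟨hr, hrρ⟩⟩
  intro ρ l e b n κ₁ κ₂ κ₃ hρ hframe
  have hsmall : ∀ᶠ r in 𝓝[>] 0,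
      IsConormalFrame f r (l r) (e r) (b r) (n r) (κ₁ r) (κ₂ r) (κ₃ r) := by
    filter_upwards [Ioo_mem_nhdsGT hρ] with r hr using hframe r hr.1 hr.2
  have hfirst : IsFirstTerm κ₂ {θ | Real.sin θ ≠ 0}
      fun θ => quarticG α β γ (Real.cos θ / Real.sin θ) := by
    obtain ⟨s, hs⟩ := exists_quarticG_ne_zero α β γ
    obtain ⟨φ, hφ, rfl⟩ := exists_cos_div_sin_eq s
    have hQ θ := normalSqForm_pos β hγ (polarPt_ne_zero one_ne_zero θ)
    exact ⟨⟨φ, hφ, hs⟩, 1, fun θ => Real.sin θ ^ 2 / √(normalSqForm β γ (polarPt 1 θ)),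
      fun θ hθ => div_ne_zero (pow_ne_zero 2 hθ) (Real.sqrt_ne_zero'.2 (hQ θ)),
      fun θ hθ => hf.hasLeadingTerm_kappa_two hγ hsmall hθ⟩
  exact ⟨⟨_, hfirst⟩, fun c hc θ hθ => hc.eq_zero_iff hfirst hθ⟩

theorem mainTheorem7 (k : ℕ) (hk : 3 ≤ k) (a : ℕ → ℕ → ℝ) (b : ℕ → ℝ) (R₁ R₂ : ℝ × ℝ → ℝ)
    (ha : 0 < a 0 2) (hR₁ : IsGermOfOrder (k + 1) R₁) (hR₂ : IsGermOfOrder (k + 1) R₂) :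
    -- for small `r > 0` the frame exists
    (∃ ρ : ℝ, 0 < ρ ∧ ∀ r : ℝ, 0 < r → r < ρ →
      ∃ (l : ℝ → ℝ) (e bb n : ℝ → Fin 3 → ℝ) (κ₁ κ₂ κ₃ : ℝ → ℝ),
        IsConormalFrame (whitneyNormalForm k a b R₁ R₂) r l e bb n κ₁ κ₂ κ₃) ∧
    -- and for every choice of it `κ₂` has a first term, which vanishes exactly when `g(cot θ) = 0`
    ∀ (ρ : ℝ) (l : ℝ → ℝ → ℝ) (e bb n : ℝ → ℝ → Fin 3 → ℝ) (κ₁ κ₂ κ₃ : ℝ → ℝ → ℝ), 0 < ρ →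
      (∀ r : ℝ, 0 < r → r < ρ →
        IsConormalFrame (whitneyNormalForm k a b R₁ R₂) r (l r) (e r) (bb r) (n r)
          (κ₁ r) (κ₂ r) (κ₃ r)) →
      (∃ c : ℝ → ℝ, IsFirstTerm κ₂ {θ | Real.sin θ ≠ 0} c) ∧
      ∀ c : ℝ → ℝ, IsFirstTerm κ₂ {θ | Real.sin θ ≠ 0} c →
        ∀ θ : ℝ, Real.sin θ ≠ 0 →
          (c θ = 0 ↔
            quarticG (a 2 0) (a 1 1) (a 0 2) (Real.cos θ / Real.sin θ) = 0) :=
  mainTheorem7_general ha.ne' (hasUmbrellaJet_whitneyNormalForm (by omega) a b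
    (hR₁.mono (by omega)) (hR₂.mono (by omega)))
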